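/- Marginal contributions to drawdown risk. Let $(\Omega,\mathcal F,\mathbb P)$ be a probability space, let $X_{i,t_1},\dots,X_{i,t_n}$ ($i$ in a finite index set) be integrable random variables, the path of factor $i$, let $w=(w_i)$ be real exposures, and let $P_{t}=\sum_i w_iX_{i,t}$ be the path of the portfolio. Fix a sign $s\in\{1,-1\}$ and define the maximum drawdown of a path $x=(x_1,\dots,x_n)$ by $$\mu(x)=\max_{1\le j<k\le n}\max\{s\,(x_k-x_j),\,0\}$$ (so $s=-1$ measures falls from a peak to a later trough, and $s=1$ measures $x_k-x_j$, for paths recorded as losses). For $\alpha\in[0,1)$ let $$\mathrm{DT}_\alpha(P)=\inf\{m:\mathbb P(\mu(P)>m)\le 1-\alpha\},\qquad \mathrm{CED}_\alpha(P)=\frac1{1-\alpha}\int_\alpha^1\mathrm{DT}_u(P)\,du$$ (with $\mathrm{DT}_0(P)=0$). Assume that $\mu(P)>0$ almost surely and that $\mathbb P(\mu(P)=\mathrm{DT}_\alpha(P))=0$ (for instance, that $\mu(P)$ has a continuous distribution). Then there are random indices $j^*<k^*$ with $\mu(P)=s\,(P_{t_{k^*}}-P_{t_{j^*}})$ almost surely,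 and for every such measurable choice of $j^*,k^*$ the following hold. (1) For every $i$ such that $\mathrm{CED}_\alpha(P)$ is differentiable in $w_i$ at $w$, $$\frac{\partial\,\mathrm{CED}_\alpha(P)}{\partial w_i}=\mathbb E\bigl[s\,(X_{i,t_{k^*}}-X_{i,t_{j^*}})\,\big|\,\mu(P)>\mathrm{DT}_\alpha(P)\bigr].$$ (2) If almost surely on the event $\mu(P)>\mathrm{DT}_\alpha(P)$ the pair $(j^*,k^*)$ is the only pair of indices $j<k$ with $\mu(P)=s\,(P_{t_k}-P_{t_j})$, then $\mathrm{CED}_\alpha(P)$ is differentiable in $w_i$ at $w$ for every $i$. (3) $\sum_i w_i\,\mathbb E\bigl[s\,(X_{i,t_{k^*}}-X_{i,t_{j^*}})\,\big|\,\mu(P)>\mathrm{DT}_\alpha(P)\bigr]=\mathrm{CED}_\alpha(P)$; hence, if $\mathrm{CED}_\alpha(P)$ is differentiable in every $w_i$ at $w$, then $\sum_i w_i\,\partial\,\mathrm{CED}_\alpha(P)/\partial w_i=\mathrm{CED}_\alpha(P)$. -/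

import Mathlib

open MeasureTheory ProbabilityTheory

noncomputable section

/-- The maximum drawdown of a finite path `x = (x 0, …, x (n-1))`: the maximum of `0` and of the
signed increments `s * (x k - x j)` over all pairs of times `j < k`. The sign `s = -1` measures
falls from a peak to a later trough (paths of returns or of values); `s = 1` measures
`x k - x j` (paths recorded as losses). -/
def maxDrawdown {n : ℕ} (s : ℝ) (x : Fin n → ℝ) : ℝ :=
  (insert (0 : ℝ) ((Finset.univ.filter fun p : Fin n × Fin n => p.1 < p.2).image
    fun p => s * (x p.2 - x p.1))).max' (Finset.insert_nonempty _ _)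

/-- The maximum drawdown of the path `x` is attained on the time interval `[j, k]`. -/
def IsDrawdownInterval {n : ℕ} (s : ℝ) (x : Fin n → ℝ) (j k : Fin n) : Prop :=
  j < k ∧ maxDrawdown s x = s * (x k - x j)

/-- The threshold `inf {m | Pr (Z > m) ≤ 1 - α}`, that is, the lower `α`-quantile of `Z`.
(For `α = 0` the set is all of `ℝ` and the value is `0`, the least possible drawdown.) -/
def drawdownThreshold {Ω : Type*} [MeasurableSpace Ω] (Pr : Measure Ω) (Z : Ω → ℝ) (α : ℝ) : ℝ :=
  sInf {m : ℝ | Pr.real {ω | m < Z ω} ≤ 1 - α}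

/-- The `α`-tail mean of `Z`: the average of its `u`-quantiles over `u ∈ [α, 1]`. -/
def tailMean {Ω : Type*} [MeasurableSpace Ω] (Pr : Measure Ω) (α : ℝ) (Z : Ω → ℝ) : ℝ :=
  (1 / (1 - α)) * ∫ u in α..1, drawdownThreshold Pr Z u

/-- Conditional Expected Drawdown of a random path: the tail mean of its maximum drawdown. -/
def CED {Ω : Type*} [MeasurableSpace Ω] {n : ℕ} (s : ℝ) (Pr : Measure Ω) (α : ℝ)
    (Y : Ω → Fin n → ℝ) : ℝ :=
  tailMean Pr α fun ω => maxDrawdown s (Y ω)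

/-- The path of the portfolio with exposures `w` to the factors `X i`; `X i t` is the random value
of factor `i` at time `t`. -/
def portfolioPath {Ω ι : Type*} [Fintype ι] {n : ℕ} (X : ι → Fin n → Ω → ℝ) (w : ι → ℝ) :
    Ω → Fin n → ℝ :=
  fun ω t => ∑ i, w i * X i t ω

/-- `ρ`, as a function of the single exposure `i`, is differentiable at `w`. -/
def PartialDifferentiableAt {ι : Type*} [DecidableEq ι] (ρ : (ι → ℝ) → ℝ) (w : ι → ℝ) (i : ι) :
    Prop :=
  DifferentiableAt ℝ (fun y : ℝ => ρ (Function.update w i y)) (w i)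

/-- The marginal risk contribution: the partial derivative of `ρ` at `w` along the exposure `i`. -/
def marginalContribution {ι : Type*} [DecidableEq ι] (ρ : (ι → ℝ) → ℝ) (w : ι → ℝ) (i : ι) : ℝ :=
  deriv (fun y : ℝ => ρ (Function.update w i y)) (w i)

/-- The event that the maximum drawdown of the random path `Y` exceeds its threshold at `α`. -/
def breachEvent {Ω : Type*} [MeasurableSpace Ω] {n : ℕ} (s : ℝ) (Pr : Measure Ω) (α : ℝ)
    (Y : Ω → Fin n → ℝ) : Set Ω :=
  {ω | drawdownThreshold Pr (fun ω' => maxDrawdown s (Y ω')) α < maxDrawdown s (Y ω)}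

end

open Set Filter Topology

/-! ### Quantiles and the tail mean of a nonnegative random variable -/

section Quantile

/-! The tail mean has two variational descriptions. From above, `(1 - α) * tailMean` is at most `c *
(1 - α) + E (Z - c)⁺` for every `c`, with equality at the threshold (`one_sub_mul_tailMean_le`,
`one_sub_mul_tailMean_eq`). From below, it is at least the integral of `Z` over any event of
probability `1 - α`, with equality at the breach event when the threshold carries no mass.

Now vary one exposure. Freezing the breach event and the interval `[J, K]` of the base portfolio
gives an affine minorant of CED touching it at `w` (`affine_le_CED_update`). A function that is
differentiable at a point where an affine minorant touches it has the minorant's slope there, which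
is (1). Freezing the threshold instead gives a touching majorant. If the optimal interval is unique
on the breach event, dominated differentiation shows that the majorant has the same slope
(`hasDerivAt_integral_max_maxDrawdown`), and the sandwich forces differentiability, which is (2).
Finally, (3) is linearity of the increment over the frozen interval in the factors. -/

theorem one_sub_mul_tailMean {Ω : Type*} [MeasurableSpace Ω] {Pr : Measure Ω} {Z : Ω → ℝ} {α : ℝ}
    (hα1 : α < 1) :
    (1 - α) * tailMean Pr α Z = ∫ u in Ioo α 1, drawdownThreshold Pr Z u := by
  have : 1 - α ≠ 0 := (sub_pos.2 hα1).ne'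
  rw [tailMean, intervalIntegral.integral_of_le hα1.le, integral_Ioc_eq_integral_Ioo]
  field_simp

variable {Ω : Type*} [MeasurableSpace Ω] {Pr : Measure Ω} [IsProbabilityMeasure Pr] {Z : Ω → ℝ}

theorem real_lt_eq_one_sub_cdf (hZ : Measurable Z) (m : ℝ) :
    Pr.real {ω | m < Z ω} = 1 - cdf (Pr.map Z) m := by
  have := Measure.isProbabilityMeasure_map (μ := Pr) hZ.aemeasurable
  rw [cdf_eq_real, map_measureReal_apply hZ measurableSet_Iic,
    ← probReal_compl_eq_one_sub (hZ measurableSet_Iic)]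
  congr 1
  ext ω
  simp

/-- The Galois connection between quantile and distribution function. Right-continuity of the latter
makes the infimum attained. -/
theorem drawdownThreshold_le_iff (hZ : Measurable Z) {u : ℝ} (hu : u ∈ Ioo (0 : ℝ) 1) (m : ℝ) :
    drawdownThreshold Pr Z u ≤ m ↔ u ≤ cdf (Pr.map Z) m := by
  have hprob := Measure.isProbabilityMeasure_map (μ := Pr) hZ.aemeasurable
  set F := cdf (Pr.map Z) with hF
  have hset : {m : ℝ | Pr.real {ω | m < Z ω} ≤ 1 - u} = {m | u ≤ F m} := by
    ext m
    rw [mem_ofPred_eq, mem_ofPred_eq, real_lt_eq_one_sub_cdf hZ, sub_le_sub_iff_left]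
  have hbdd : BddBelow {m | u ≤ F m} := by
    obtain ⟨a, ha⟩ := ((tendsto_cdf_atBot (Pr.map Z)).eventually_lt_const hu.1).exists
    refine ⟨a, fun m hm => ?_⟩
    by_contra! h
    exact absurd (hm.trans (monotone_cdf _ h.le)) (not_le.2 ha)
  have hne : {m | u ≤ F m}.Nonempty := by
    obtain ⟨a, ha⟩ := ((tendsto_cdf_atTop (Pr.map Z)).eventually_const_lt hu.2).exists
    exact ⟨a, ha.le⟩
  unfold drawdownThreshold
  rw [hset]
  refine ⟨fun h => ?_, fun h => csInf_le hbdd h⟩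
  have hright : Tendsto F (𝓝[>] m) (𝓝 (F m)) :=
    (F.right_continuous m).tendsto.mono_left (nhdsWithin_mono _ Ioi_subset_Ici_self)
  refine ge_of_tendsto hright ?_
  filter_upwards [self_mem_nhdsWithin] with x hx
  obtain ⟨y, hy, hyx⟩ := exists_lt_of_csInf_lt hne (h.trans_lt hx)
  exact le_trans hy (monotone_cdf _ hyx.le)

/-- The set is all of `ℝ`, where `sInf` takes its default value `0`. For nonnegative `Z` this keeps
the threshold monotone down to level `0`, so `α = 0` needs no separate treatment later. -/
theorem drawdownThreshold_zero : drawdownThreshold Pr Z 0 = 0 := by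
  have : {m : ℝ | Pr.real {ω | m < Z ω} ≤ 1 - 0} = univ := by
    ext m
    simp [measureReal_le_one]
  rw [drawdownThreshold, this, Real.sInf_univ]

theorem drawdownThreshold_nonneg (hZ : Measurable Z) (hZ0 : ∀ ω, 0 ≤ Z ω) {u : ℝ}
    (hu : u ∈ Ico (0 : ℝ) 1) : 0 ≤ drawdownThreshold Pr Z u := by
  have hprob := Measure.isProbabilityMeasure_map (μ := Pr) hZ.aemeasurable
  rcases hu.1.eq_or_lt with rfl | h0
  · rw [drawdownThreshold_zero]
  · by_contra! hneg
    have h := (drawdownThreshold_le_iff (Pr := Pr) hZ ⟨h0, hu.2⟩ _).1 le_rfl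
    rw [cdf_eq_real, map_measureReal_apply hZ measurableSet_Iic] at h
    have : Z ⁻¹' Iic (drawdownThreshold Pr Z u) = ∅ := by
      ext ω
      simp [hneg.trans_le (hZ0 ω)]
    rw [this, measureReal_empty] at h
    exact absurd h (not_le.2 h0)

theorem drawdownThreshold_mono (hZ : Measurable Z) (hZ0 : ∀ ω, 0 ≤ Z ω) :
    MonotoneOn (drawdownThreshold Pr Z) (Ico 0 1) := by
  intro u hu v hv huv
  rcases hu.1.eq_or_lt with rfl | h0
  · rw [drawdownThreshold_zero]
    exact drawdownThreshold_nonneg hZ hZ0 hv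
  · rw [drawdownThreshold_le_iff hZ ⟨h0, hu.2⟩]
    exact huv.trans ((drawdownThreshold_le_iff hZ ⟨h0.trans_le huv, hv.2⟩ _).1 le_rfl)

theorem aemeasurable_drawdownThreshold (hZ : Measurable Z) (hZ0 : ∀ ω, 0 ≤ Z ω) :
    AEMeasurable (drawdownThreshold Pr Z) (volume.restrict (Ioo 0 1)) :=
  aemeasurable_restrict_of_monotoneOn measurableSet_Ioo
    ((drawdownThreshold_mono hZ hZ0).mono Ioo_subset_Ico_self)

/-- The quantile transform: the quantile at a uniform random level has the original law. -/
theorem map_drawdownThreshold (hZ : Measurable Z) (hZ0 : ∀ ω, 0 ≤ Z ω) :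
    (volume.restrict (Ioo (0 : ℝ) 1)).map (drawdownThreshold Pr Z) = Pr.map Z := by
  have hprob := Measure.isProbabilityMeasure_map (μ := Pr) hZ.aemeasurable
  have : IsFiniteMeasure ((volume.restrict (Ioo (0 : ℝ) 1)).map (drawdownThreshold Pr Z)) :=
    Measure.isFiniteMeasure_map _ _
  refine Measure.ext_of_Iic _ _ fun m => ?_
  rw [Measure.map_apply_of_aemeasurable (aemeasurable_drawdownThreshold hZ hZ0) measurableSet_Iic,
    ← ofReal_cdf, Measure.restrict_apply' measurableSet_Ioo]
  -- Only almost everywhere: the level `u = 1` lies in the right-hand set when the distribution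
  -- function equals `1` at `m`.
  have hset : (drawdownThreshold Pr Z ⁻¹' Iic m ∩ Ioo 0 1 : Set ℝ) =ᵐ[volume]
      (Ioc 0 (cdf (Pr.map Z) m) : Set ℝ) := by
    have h1 : ∀ᵐ u : ℝ, u ≠ 1 := by simp [ae_iff]
    filter_upwards [h1] with u hu1
    refine propext ?_
    change (drawdownThreshold Pr Z u ≤ m ∧ u ∈ Ioo 0 1) ↔ (0 < u ∧ u ≤ _)
    constructor
    · rintro ⟨h, hu⟩
      exact ⟨hu.1, (drawdownThreshold_le_iff hZ hu m).1 h⟩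
    · rintro ⟨h0, h⟩
      have hu : u ∈ Ioo (0 : ℝ) 1 := ⟨h0, lt_of_le_of_ne (h.trans (cdf_le_one _ m)) hu1⟩
      exact ⟨(drawdownThreshold_le_iff hZ hu m).2 h, hu⟩
  rw [measure_congr hset, Real.volume_Ioc, sub_zero]

theorem integral_comp_drawdownThreshold (hZ : Measurable Z) (hZ0 : ∀ ω, 0 ≤ Z ω) {φ : ℝ → ℝ}
    (hφ : Continuous φ) :
    ∫ u in Ioo (0 : ℝ) 1, φ (drawdownThreshold Pr Z u) = ∫ ω, φ (Z ω) ∂Pr := by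
  rw [← integral_map (f := φ) hZ.aemeasurable hφ.aestronglyMeasurable,
    ← map_drawdownThreshold hZ hZ0,
    integral_map (aemeasurable_drawdownThreshold hZ hZ0) hφ.aestronglyMeasurable]

theorem integrableOn_drawdownThreshold (hZ : Measurable Z) (hZ0 : ∀ ω, 0 ≤ Z ω)
    (hZi : Integrable Z Pr) : IntegrableOn (drawdownThreshold Pr Z) (Ioo 0 1) := by
  have h : Integrable id (Pr.map Z) :=
    (integrable_map_measure aestronglyMeasurable_id hZ.aemeasurable).2 hZi
  rw [← map_drawdownThreshold hZ hZ0] at h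
  exact (integrable_map_measure aestronglyMeasurable_id
    (aemeasurable_drawdownThreshold hZ hZ0)).1 h

/-- Each quantile `q` satisfies `q ≤ c + (q - c)⁺`. Integrate over the levels above `α`, enlarge the
domain of the positive part to all levels, and apply the quantile transform. -/
theorem one_sub_mul_tailMean_le (hZ : Measurable Z) (hZ0 : ∀ ω, 0 ≤ Z ω) (hZi : Integrable Z Pr)
    {α : ℝ} (hα0 : 0 ≤ α) (hα1 : α < 1) (c : ℝ) :
    (1 - α) * tailMean Pr α Z ≤ c * (1 - α) + ∫ ω, max (Z ω - c) 0 ∂Pr := by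
  have hq := integrableOn_drawdownThreshold hZ hZ0 hZi
  have hsub : Ioo α 1 ⊆ Ioo (0 : ℝ) 1 := Ioo_subset_Ioo_left hα0
  have hint : IntegrableOn (fun u => max (drawdownThreshold Pr Z u - c) 0) (Ioo 0 1) :=
    (hq.sub (integrable_const c)).pos_part
  rw [one_sub_mul_tailMean hα1, ← integral_comp_drawdownThreshold (φ := fun x => max (x - c) 0)
    hZ hZ0 (by fun_prop)]
  calc ∫ u in Ioo α 1, drawdownThreshold Pr Z u
      ≤ ∫ u in Ioo α 1, (c + max (drawdownThreshold Pr Z u - c) 0) := by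
        refine integral_mono (hq.mono_set hsub)
          ((integrable_const c).add (hint.mono_set hsub)) fun u => ?_
        change _ ≤ c + _
        linarith [le_max_left (drawdownThreshold Pr Z u - c) 0]
    _ = c * (1 - α) + ∫ u in Ioo α 1, max (drawdownThreshold Pr Z u - c) 0 := by
        rw [integral_add (integrable_const c) (hint.mono_set hsub)]
        simp [hα1.le, mul_comm]
    _ ≤ _ := by
        gcongr
        exact Eventually.of_forall fun u => le_max_right _ _

/-- By monotonicity, quantiles are at most `c` below level `α` and at least `c` above it, so neither
inequality in the upper bound loses anything. -/
theorem one_sub_mul_tailMean_eq (hZ : Measurable Z) (hZ0 : ∀ ω, 0 ≤ Z ω) (hZi : Integrable Z Pr)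
    {α : ℝ} (hα0 : 0 ≤ α) (hα1 : α < 1) :
    (1 - α) * tailMean Pr α Z = drawdownThreshold Pr Z α * (1 - α) +
      ∫ ω, max (Z ω - drawdownThreshold Pr Z α) 0 ∂Pr := by
  set c := drawdownThreshold Pr Z α with hc
  have hq := integrableOn_drawdownThreshold hZ hZ0 hZi
  have hsub : Ioo α 1 ⊆ Ioo (0 : ℝ) 1 := Ioo_subset_Ioo_left hα0
  have hmono := drawdownThreshold_mono (Pr := Pr) hZ hZ0
  rw [one_sub_mul_tailMean hα1, ← integral_comp_drawdownThreshold (φ := fun x => max (x - c) 0)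
    hZ hZ0 (by fun_prop)]
  have h1 : ∫ u in Ioo (0 : ℝ) 1, max (drawdownThreshold Pr Z u - c) 0 =
      ∫ u in Ioo α 1, max (drawdownThreshold Pr Z u - c) 0 := by
    refine (setIntegral_eq_of_subset_of_forall_sdiff_eq_zero measurableSet_Ioo hsub ?_)
    rintro u ⟨hu, hu'⟩
    have hle : u ≤ α := by
      by_contra! h
      exact hu' ⟨h, hu.2⟩
    exact max_eq_right (sub_nonpos.2 (hmono ⟨hu.1.le, hu.2⟩ ⟨hα0, hα1⟩ hle))
  have h2 : ∫ u in Ioo α 1, max (drawdownThreshold Pr Z u - c) 0 =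
      ∫ u in Ioo α 1, (drawdownThreshold Pr Z u - c) :=
    setIntegral_congr_fun measurableSet_Ioo fun u hu =>
      max_eq_left (sub_nonneg.2 (hmono ⟨hα0, hα1⟩ ⟨hα0.trans hu.1.le, hu.2⟩ hu.1.le))
  rw [h1, h2, integral_sub (hq.mono_set hsub) (integrable_const c)]
  simp [hα1.le, mul_comm]

theorem setIntegral_le_add_integral_max (hZi : Integrable Z Pr) {A : Set Ω}
    (c : ℝ) : ∫ ω in A, Z ω ∂Pr ≤ c * Pr.real A + ∫ ω, max (Z ω - c) 0 ∂Pr := by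
  have hint : Integrable (fun ω => max (Z ω - c) 0) Pr := (hZi.sub (integrable_const c)).pos_part
  calc ∫ ω in A, Z ω ∂Pr ≤ ∫ ω in A, (c + max (Z ω - c) 0) ∂Pr := by
        refine integral_mono hZi.integrableOn
          ((integrable_const c).add hint.integrableOn) fun ω => ?_
        change _ ≤ c + _
        linarith [le_max_left (Z ω - c) 0]
    _ = c * Pr.real A + ∫ ω in A, max (Z ω - c) 0 ∂Pr := by
        rw [integral_add (integrable_const c) hint.integrableOn]
        simp [mul_comm]
    _ ≤ _ := by
        gcongr
        · exact Eventually.of_forall fun ω => le_max_right _ _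
        · exact Measure.restrict_le_self

theorem setIntegral_le_one_sub_mul_tailMean (hZ : Measurable Z) (hZ0 : ∀ ω, 0 ≤ Z ω)
    (hZi : Integrable Z Pr) {α : ℝ} (hα0 : 0 ≤ α) (hα1 : α < 1) {A : Set Ω}
    (hA : Pr.real A = 1 - α) : ∫ ω in A, Z ω ∂Pr ≤ (1 - α) * tailMean Pr α Z := by
  rw [one_sub_mul_tailMean_eq hZ hZ0 hZi hα0 hα1, ← hA]
  exact setIntegral_le_add_integral_max hZi _

/-- By monotonicity of the quantile, `Z > c` only uses levels above `α` and `Z < c` only levels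
below it. The two probabilities are thus at most `1 - α` and `α`; without an atom at `c` they sum to
`1`, so both bounds are equalities. -/
theorem real_drawdownThreshold_lt (hZ : Measurable Z) (hZ0 : ∀ ω, 0 ≤ Z ω)
    {α : ℝ} (hα0 : 0 ≤ α) (hα1 : α < 1)
    (hcont : Pr {ω | Z ω = drawdownThreshold Pr Z α} = 0) :
    Pr.real {ω | drawdownThreshold Pr Z α < Z ω} = 1 - α := by
  set c := drawdownThreshold Pr Z α with hc
  have hmono := drawdownThreshold_mono (Pr := Pr) hZ hZ0
  have hlaw : ∀ S : Set ℝ, MeasurableSet S →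
      Pr (Z ⁻¹' S) = volume (drawdownThreshold Pr Z ⁻¹' S ∩ Ioo 0 1) := by
    intro S hS
    rw [← Measure.map_apply hZ hS, ← map_drawdownThreshold hZ hZ0,
      Measure.map_apply_of_aemeasurable (aemeasurable_drawdownThreshold hZ hZ0) hS,
      Measure.restrict_apply' measurableSet_Ioo]
  have hgt : Pr.real (Z ⁻¹' Ioi c) ≤ 1 - α := by
    rw [Measure.real, hlaw _ measurableSet_Ioi]
    refine ENNReal.toReal_le_of_le_ofReal (sub_nonneg.2 hα1.le) ?_
    rw [← Real.volume_Ioo]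
    refine measure_mono ?_
    rintro u ⟨hu, hu'⟩
    refine ⟨?_, hu'.2⟩
    by_contra! h
    exact absurd (hmono ⟨hu'.1.le, hu'.2⟩ ⟨hα0, hα1⟩ h) (not_le.2 hu)
  have hlt : Pr.real (Z ⁻¹' Iio c) ≤ α := by
    rw [Measure.real, hlaw _ measurableSet_Iio]
    refine ENNReal.toReal_le_of_le_ofReal hα0 ?_
    rw [← sub_zero α, ← Real.volume_Ioo]
    refine measure_mono ?_
    rintro u ⟨hu, hu'⟩
    refine ⟨hu'.1, ?_⟩
    by_contra! h
    exact absurd (hmono ⟨hα0, hα1⟩ ⟨hu'.1.le, hu'.2⟩ h) (not_le.2 hu)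
  have hle : Pr.real (Z ⁻¹' Iic c) = Pr.real (Z ⁻¹' Iio c) := by
    refine measureReal_congr ?_
    have hne : ∀ᵐ ω ∂Pr, Z ω ≠ c := by
      rw [ae_iff]
      simpa using hcont
    filter_upwards [hne] with ω hω
    exact propext (show Z ω ≤ c ↔ Z ω < c from ⟨fun h => lt_of_le_of_ne h hω, le_of_lt⟩)
  have hcompl := probReal_compl_eq_one_sub (μ := Pr) (hZ (measurableSet_Iic (a := c)))
  rw [← preimage_compl, compl_Iic, hle] at hcompl
  change Pr.real (Z ⁻¹' Ioi c) = _
  linarith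

theorem one_sub_mul_tailMean_eq_setIntegral (hZ : Measurable Z) (hZ0 : ∀ ω, 0 ≤ Z ω)
    (hZi : Integrable Z Pr) {α : ℝ} (hα0 : 0 ≤ α) (hα1 : α < 1)
    (hcont : Pr {ω | Z ω = drawdownThreshold Pr Z α} = 0) :
    (1 - α) * tailMean Pr α Z = ∫ ω in {ω | drawdownThreshold Pr Z α < Z ω}, Z ω ∂Pr := by
  have hA := real_drawdownThreshold_lt hZ hZ0 hα0 hα1 hcont
  rw [one_sub_mul_tailMean_eq hZ hZ0 hZi hα0 hα1]
  set c := drawdownThreshold Pr Z α with hc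
  have hAm : MeasurableSet {ω | c < Z ω} := measurableSet_lt measurable_const hZ
  have h : ∫ ω, max (Z ω - c) 0 ∂Pr = ∫ ω in {ω | c < Z ω}, (Z ω - c) ∂Pr := by
    rw [← integral_indicator hAm]
    congr 1
    ext ω
    by_cases hω : c < Z ω
    · rw [indicator_of_mem (by exact hω), max_eq_left (sub_nonneg.2 hω.le)]
    · rw [indicator_of_notMem (by exact hω), max_eq_right (sub_nonpos.2 (not_lt.1 hω))]
  rw [h, integral_sub hZi.integrableOn (integrable_const c), setIntegral_const, hA, smul_eq_mul]
  ring

end Quantile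

/-! ### Maximum drawdown of a path: attainment, Lipschitz bound, measurable selection -/

section MaxDrawdown

variable {n : ℕ} {s : ℝ}

theorem maxDrawdown_nonneg (s : ℝ) (x : Fin n → ℝ) : 0 ≤ maxDrawdown s x :=
  Finset.le_max' _ _ (Finset.mem_insert_self _ _)

theorem le_maxDrawdown (s : ℝ) (x : Fin n → ℝ) {j k : Fin n} (h : j < k) :
    s * (x k - x j) ≤ maxDrawdown s x :=
  Finset.le_max' _ _ <| Finset.mem_insert_of_mem <|
    Finset.mem_image_of_mem (fun p : Fin n × Fin n => s * (x p.2 - x p.1))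
      (Finset.mem_filter.2 ⟨Finset.mem_univ (j, k), h⟩)

theorem maxDrawdown_le {x : Fin n → ℝ} {C : ℝ} (hC : 0 ≤ C)
    (h : ∀ j k, j < k → s * (x k - x j) ≤ C) : maxDrawdown s x ≤ C := by
  refine Finset.max'_le _ _ _ fun y hy => ?_
  simp only [Finset.mem_insert, Finset.mem_image, Finset.mem_filter, Finset.mem_univ, true_and,
    Prod.exists] at hy
  rcases hy with rfl | ⟨j, k, hjk, rfl⟩
  · exact hC
  · exact h j k hjk

theorem exists_isDrawdownInterval {x : Fin n → ℝ} (h : 0 < maxDrawdown s x) :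
    ∃ p : Fin n × Fin n, IsDrawdownInterval s x p.1 p.2 := by
  by_contra! hno
  have hmem := Finset.max'_mem _ (Finset.insert_nonempty (0 : ℝ)
    ((Finset.univ.filter fun p : Fin n × Fin n => p.1 < p.2).image fun p => s * (x p.2 - x p.1)))
  rw [Finset.mem_insert, Finset.mem_image] at hmem
  rcases hmem with h0 | ⟨p, hp, hpx⟩
  · exact h.ne' h0
  · exact hno p ⟨(Finset.mem_filter.1 hp).2, hpx.symm⟩

theorem maxDrawdown_le_add {x y : Fin n → ℝ} {B : ℝ} (hB : 0 ≤ B)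
    (h : ∀ j k, j < k → s * (x k - x j) ≤ s * (y k - y j) + B) :
    maxDrawdown s x ≤ maxDrawdown s y + B :=
  maxDrawdown_le (add_nonneg (maxDrawdown_nonneg s y) hB) fun j k hjk =>
    (h j k hjk).trans (add_le_add_left (le_maxDrawdown s y hjk) B)

theorem mul_sub_sub_mul_sub_le_sum (hs : |s| = 1) (x y : Fin n → ℝ) (j k : Fin n) :
    s * (x k - x j) ≤ s * (y k - y j) + 2 * ∑ t, |x t - y t| := by
  have hj := Finset.single_le_sum (f := fun t => |x t - y t|) (fun t _ => abs_nonneg _)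
    (Finset.mem_univ j)
  have hk := Finset.single_le_sum (f := fun t => |x t - y t|) (fun t _ => abs_nonneg _)
    (Finset.mem_univ k)
  have h : s * ((x k - y k) - (x j - y j)) ≤ |x k - y k| + |x j - y j| := by
    refine (le_abs_self _).trans ?_
    rw [abs_mul, hs, one_mul]
    exact abs_sub _ _
  linarith

/-- A maximum of increments moves by no more than the largest change of an increment. This yields
continuity, integrability, and the dominating function for differentiating under the integral. -/
theorem abs_maxDrawdown_sub_le (hs : |s| = 1) (x y : Fin n → ℝ) :
    |maxDrawdown s x - maxDrawdown s y| ≤ 2 * ∑ t, |x t - y t| := by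
  have hB : ∀ x y : Fin n → ℝ, 0 ≤ 2 * ∑ t, |x t - y t| := fun x y =>
    mul_nonneg zero_le_two (Finset.sum_nonneg fun t _ => abs_nonneg _)
  have h1 := maxDrawdown_le_add (hB x y) fun j k _ => mul_sub_sub_mul_sub_le_sum hs x y j k
  have h2 := maxDrawdown_le_add (hB y x) fun j k _ => mul_sub_sub_mul_sub_le_sum hs y x j k
  simp only [abs_sub_comm (y _)] at h2
  rw [abs_le]
  constructor <;> linarith

theorem continuous_maxDrawdown (hs : |s| = 1) :
    Continuous (maxDrawdown s : (Fin n → ℝ) → ℝ) := by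
  rw [continuous_iff_continuousAt]
  intro y
  rw [ContinuousAt, tendsto_iff_dist_tendsto_zero]
  have h : Tendsto (fun x : Fin n → ℝ => 2 * ∑ t, |x t - y t|) (𝓝 y) (𝓝 0) := by
    have : Continuous fun x : Fin n → ℝ => 2 * ∑ t, |x t - y t| := by fun_prop
    simpa using this.tendsto y
  exact squeeze_zero (fun _ => dist_nonneg) (fun x => abs_maxDrawdown_sub_le hs x y) h

theorem maxDrawdown_zero_path (s : ℝ) : maxDrawdown s (fun _ : Fin n => (0 : ℝ)) = 0 :=
  le_antisymm (maxDrawdown_le le_rfl fun j k _ => by simp) (maxDrawdown_nonneg _ _)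

theorem integrable_maxDrawdown {Ω : Type*} [MeasurableSpace Ω] {Pr : Measure Ω} (hs : |s| = 1)
    {Y : Ω → Fin n → ℝ} (hY : ∀ t, Integrable (fun ω => Y ω t) Pr) :
    Integrable (fun ω => maxDrawdown s (Y ω)) Pr := by
  have hdom : Integrable (fun ω => 2 * ∑ t, |Y ω t|) Pr :=
    (integrable_finsetSum _ fun t _ => (hY t).abs).const_mul 2
  refine hdom.mono' ((continuous_maxDrawdown hs).comp_aestronglyMeasurable
    (aemeasurable_pi_lambda _ fun t => (hY t).aemeasurable).aestronglyMeasurable) ?_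
  refine Eventually.of_forall fun ω => ?_
  simpa [maxDrawdown_zero_path] using abs_maxDrawdown_sub_le hs (Y ω) fun _ => 0

theorem measurable_maxDrawdown {Ω : Type*} [MeasurableSpace Ω] (hs : |s| = 1)
    {Y : Ω → Fin n → ℝ} (hY : ∀ t, Measurable fun ω => Y ω t) :
    Measurable fun ω => maxDrawdown s (Y ω) :=
  (continuous_maxDrawdown hs).measurable.comp (measurable_pi_lambda _ hY)

theorem measurableSet_isDrawdownInterval {Ω : Type*} [MeasurableSpace Ω] (hs : |s| = 1)
    {Y : Ω → Fin n → ℝ} (hY : ∀ t, Measurable fun ω => Y ω t) (j k : Fin n) :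
    MeasurableSet {ω | IsDrawdownInterval s (Y ω) j k} :=
  (MeasurableSet.const _).inter <| measurableSet_eq_fun (measurable_maxDrawdown hs hY)
    (((hY k).sub (hY j)).const_mul s)

/-- If one of finitely many measurable events occurs, it can be selected measurably. -/
theorem exists_measurable_selection {Ω β : Type*} [MeasurableSpace Ω] [MeasurableSpace β]
    [Nonempty β] (S : β → Set Ω) (hS : ∀ b, MeasurableSet (S b)) (T : Finset β) :
    ∃ f : Ω → β, Measurable f ∧ ∀ ω, ∀ b ∈ T, ω ∈ S b → ω ∈ S (f ω) := by
  classical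
  induction T using Finset.induction_on with
  | empty => exact ⟨fun _ => Classical.arbitrary β, measurable_const, by simp⟩
  | insert a T _ ih =>
    obtain ⟨f, hf, hfS⟩ := ih
    refine ⟨fun ω => if ω ∈ S a then a else f ω, Measurable.ite (hS a) measurable_const hf,
      fun ω b hb hω => ?_⟩
    by_cases ha : ω ∈ S a
    · simp [ha]
    · rcases Finset.mem_insert.1 hb with rfl | hb
      · exact absurd hω ha
      · simpa [ha] using hfS ω b hb hω

theorem exists_measurable_isDrawdownInterval {Ω : Type*} [MeasurableSpace Ω] {Pr : Measure Ω}
    [NeZero Pr] (hs : |s| = 1) {Y : Ω → Fin n → ℝ} (hY : ∀ t, Measurable fun ω => Y ω t)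
    (hpos : ∀ᵐ ω ∂Pr, 0 < maxDrawdown s (Y ω)) :
    ∃ J K : Ω → Fin n, Measurable J ∧ Measurable K ∧
      ∀ᵐ ω ∂Pr, IsDrawdownInterval s (Y ω) (J ω) (K ω) := by
  -- A positive drawdown at some outcome rules out `n = 0`.
  have : Nonempty (Fin n × Fin n) := by
    obtain ⟨ω, hω⟩ := hpos.exists
    obtain ⟨p, -⟩ := exists_isDrawdownInterval hω
    exact ⟨p⟩
  obtain ⟨f, hf, hfS⟩ := exists_measurable_selection
    (fun p : Fin n × Fin n => {ω | IsDrawdownInterval s (Y ω) p.1 p.2})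
    (fun p => measurableSet_isDrawdownInterval hs hY p.1 p.2) Finset.univ
  refine ⟨fun ω => (f ω).1, fun ω => (f ω).2, hf.fst, hf.snd, ?_⟩
  filter_upwards [hpos] with ω hω
  obtain ⟨p, hp⟩ := exists_isDrawdownInterval hω
  exact hfS ω p (Finset.mem_univ p) hp

end MaxDrawdown

/-! ### Derivatives from touching minorants and majorants -/

section Calculus

theorem HasDerivAt.of_sandwich {l f g : ℝ → ℝ} {a d : ℝ} (hl : HasDerivAt l d a)
    (hg : HasDerivAt g d a) (hlf : ∀ x, l x ≤ f x) (hfg : ∀ x, f x ≤ g x) (hla : l a = f a)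
    (hga : g a = f a) : HasDerivAt f d a := by
  rw [hasDerivAt_iff_isLittleO] at hl hg ⊢
  -- The error of `f` against the common tangent lies between those of `l` and `g`, so it is bounded
  -- by the sum of their absolute values.
  refine Asymptotics.IsBigO.trans_isLittleO ?_ (hl.norm_left.add hg.norm_left)
  refine Asymptotics.IsBigO.of_norm_le fun x => ?_
  have h1 := hlf x
  have h2 := hfg x
  rw [hla, hga, Real.norm_eq_abs]
  simp only [Real.norm_eq_abs]
  rw [abs_le]
  constructor
  · linarith [neg_abs_le (l x - f a - (x - a) • d), abs_nonneg (g x - f a - (x - a) • d)]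
  · linarith [le_abs_self (g x - f a - (x - a) • d), abs_nonneg (l x - f a - (x - a) • d)]

theorem deriv_eq_of_hasDerivAt_le {l f : ℝ → ℝ} {a d : ℝ} (hl : HasDerivAt l d a)
    (hlf : ∀ x, l x ≤ f x) (hla : l a = f a) (hf : DifferentiableAt ℝ f a) : deriv f a = d := by
  have hmin : IsLocalMin (fun x => f x - l x) a :=
    Eventually.of_forall fun x => by
      change f a - l a ≤ f x - l x
      linarith [hlf x]
  exact sub_eq_zero.1 (hmin.hasDerivAt_eq_zero (hf.hasDerivAt.sub hl))

end Calculus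

/-! ### Perturbing one exposure of the portfolio -/

section Portfolio

variable {Ω ι : Type*} [Fintype ι] {n : ℕ} {X : ι → Fin n → Ω → ℝ}

theorem portfolioPath_update [DecidableEq ι] (X : ι → Fin n → Ω → ℝ) (w : ι → ℝ) (i : ι) (y : ℝ)
    (ω : Ω) (t : Fin n) : portfolioPath X (Function.update w i y) ω t =
      portfolioPath X w ω t + (y - w i) * X i t ω := by
  have h : ∀ j, Function.update w i y j * X j t ω =
      w j * X j t ω + if j = i then (y - w i) * X i t ω else 0 := by
    intro j
    by_cases hj : j = i
    · subst hj
      simp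
      ring
    · simp [hj]
  simp [portfolioPath, h, Finset.sum_add_distrib]

variable [MeasurableSpace Ω] {Pr : Measure Ω}

theorem measurable_portfolioPath (hXm : ∀ i t, Measurable (X i t)) (w : ι → ℝ) (t : Fin n) :
    Measurable fun ω => portfolioPath X w ω t :=
  Finset.measurable_sum _ fun i _ => (hXm i t).const_mul (w i)

theorem integrable_portfolioPath (hXi : ∀ i t, Integrable (X i t) Pr) (w : ι → ℝ) (t : Fin n) :
    Integrable (fun ω => portfolioPath X w ω t) Pr :=
  integrable_finsetSum _ fun i _ => (hXi i t).const_mul (w i)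

theorem integrable_apply_selection {Ω : Type*} [MeasurableSpace Ω] {Pr : Measure Ω}
    {Y : Fin n → Ω → ℝ} (hY : ∀ t, Integrable (Y t) Pr) {K : Ω → Fin n} (hK : Measurable K) :
    Integrable (fun ω => Y (K ω) ω) Pr := by
  have h : (fun ω => Y (K ω) ω) = fun ω => ∑ t, (K ⁻¹' {t}).indicator (Y t) ω := by
    ext ω
    rw [Finset.sum_eq_single (K ω)]
    · simp
    · intro t _ ht
      exact indicator_of_notMem (fun h => ht h.symm) _
    · simp
  rw [h]
  exact integrable_finsetSum _ fun t _ => (hY t).indicator (hK (measurableSet_singleton t))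

theorem integrable_selected_increment {Ω : Type*} [MeasurableSpace Ω] {Pr : Measure Ω}
    {Y : Fin n → Ω → ℝ} (hY : ∀ t, Integrable (Y t) Pr) {J K : Ω → Fin n} (hJ : Measurable J)
    (hK : Measurable K) (s : ℝ) : Integrable (fun ω => s * (Y (K ω) ω - Y (J ω) ω)) Pr :=
  ((integrable_apply_selection hY hK).sub (integrable_apply_selection hY hJ)).const_mul s

/-- There are finitely many competing intervals, all strictly worse at `a`, so they remain worse
nearby. Positivity does the same for the competitor `0`. -/
theorem eventually_maxDrawdown_eq {s : ℝ} {Y : ℝ → Fin n → ℝ} {a : ℝ}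
    (hY : ∀ t, ContinuousAt (fun y => Y y t) a) {j k : Fin n}
    (hpos : 0 < maxDrawdown s (Y a)) (hjk : IsDrawdownInterval s (Y a) j k)
    (huniq : ∀ j' k', IsDrawdownInterval s (Y a) j' k' → j' = j ∧ k' = k) :
    ∀ᶠ y in 𝓝 a, maxDrawdown s (Y y) = s * (Y y k - Y y j) := by
  have hc : ∀ j k, ContinuousAt (fun y => s * (Y y k - Y y j)) a := fun j k =>
    ((hY k).sub (hY j)).const_mul s
  have h0 : ∀ᶠ y in 𝓝 a, 0 < s * (Y y k - Y y j) :=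
    (hc j k).eventually_const_lt (hpos.trans_eq hjk.2)
  have hall : ∀ᶠ y in 𝓝 a, ∀ j' k', j' < k' →
      s * (Y y k' - Y y j') ≤ s * (Y y k - Y y j) := by
    refine eventually_all.2 fun j' => eventually_all.2 fun k' => ?_
    by_cases hlt : j' < k'
    · by_cases heq : j' = j ∧ k' = k
      · rw [heq.1, heq.2]
        exact Eventually.of_forall fun _ _ => le_rfl
      · have hne : s * (Y a k' - Y a j') < s * (Y a k - Y a j) := by
          rw [← hjk.2]
          exact lt_of_le_of_ne (le_maxDrawdown s _ hlt)
            fun h => heq (huniq j' k' ⟨hlt, h.symm⟩)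
        filter_upwards [(hc j' k').eventually_lt (hc j k) hne] with y hy _ using hy.le
    · exact Eventually.of_forall fun _ h => absurd h hlt
  filter_upwards [h0, hall] with y hy0 hy
  exact le_antisymm (maxDrawdown_le hy0.le hy) (le_maxDrawdown s _ hjk.1)

variable {s α : ℝ} {w : ι → ℝ} {J K : Ω → Fin n}

theorem measurableSet_breachEvent (hs : |s| = 1) (hXm : ∀ i t, Measurable (X i t)) (α : ℝ)
    (w : ι → ℝ) : MeasurableSet (breachEvent s Pr α (portfolioPath X w)) :=
  measurableSet_lt measurable_const (measurable_maxDrawdown hs (measurable_portfolioPath hXm w))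

theorem integral_cond_eq {A : Set Ω} (f : Ω → ℝ) :
    ∫ ω, f ω ∂(cond Pr A) = (Pr.real A)⁻¹ * ∫ ω in A, f ω ∂Pr := by
  rw [ProbabilityTheory.cond, integral_smul_measure, smul_eq_mul, ENNReal.toReal_inv, Measure.real]

variable [IsProbabilityMeasure Pr]

theorem real_breachEvent (hs : |s| = 1) (hα0 : 0 ≤ α) (hα1 : α < 1)
    (hXm : ∀ i t, Measurable (X i t))
    (hcont : Pr {ω | maxDrawdown s (portfolioPath X w ω) =
      drawdownThreshold Pr (fun ω' => maxDrawdown s (portfolioPath X w ω')) α} = 0) :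
    Pr.real (breachEvent s Pr α (portfolioPath X w)) = 1 - α :=
  real_drawdownThreshold_lt (measurable_maxDrawdown hs (measurable_portfolioPath hXm w))
    (fun _ => maxDrawdown_nonneg _ _) hα0 hα1 hcont

theorem CED_eq_integral_cond (hs : |s| = 1) (hα0 : 0 ≤ α) (hα1 : α < 1)
    (hXm : ∀ i t, Measurable (X i t)) (hXi : ∀ i t, Integrable (X i t) Pr)
    (hcont : Pr {ω | maxDrawdown s (portfolioPath X w ω) =
      drawdownThreshold Pr (fun ω' => maxDrawdown s (portfolioPath X w ω')) α} = 0)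
    (hJK : ∀ᵐ ω ∂Pr, IsDrawdownInterval s (portfolioPath X w ω) (J ω) (K ω)) :
    CED s Pr α (portfolioPath X w) =
      ∫ ω, s * (portfolioPath X w ω (K ω) - portfolioPath X w ω (J ω))
        ∂(cond Pr (breachEvent s Pr α (portfolioPath X w))) := by
  rw [integral_cond_eq, real_breachEvent hs hα0 hα1 hXm hcont,
    eq_inv_mul_iff_mul_eq₀ (sub_pos.2 hα1).ne']
  refine (one_sub_mul_tailMean_eq_setIntegral
    (measurable_maxDrawdown hs (measurable_portfolioPath hXm w))
    (fun _ => maxDrawdown_nonneg _ _)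
    (integrable_maxDrawdown hs (integrable_portfolioPath hXi w)) hα0 hα1 hcont).trans ?_
  refine integral_congr_ae (ae_restrict_of_ae ?_)
  filter_upwards [hJK] with ω hω using hω.2

theorem sum_mul_integral_cond_eq_CED (hs : |s| = 1) (hα0 : 0 ≤ α) (hα1 : α < 1)
    (hXm : ∀ i t, Measurable (X i t)) (hXi : ∀ i t, Integrable (X i t) Pr)
    (hcont : Pr {ω | maxDrawdown s (portfolioPath X w ω) =
      drawdownThreshold Pr (fun ω' => maxDrawdown s (portfolioPath X w ω')) α} = 0)
    (hJ : Measurable J) (hK : Measurable K)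
    (hJK : ∀ᵐ ω ∂Pr, IsDrawdownInterval s (portfolioPath X w ω) (J ω) (K ω)) :
    ∑ i, w i * ∫ ω, s * (X i (K ω) ω - X i (J ω) ω)
        ∂(cond Pr (breachEvent s Pr α (portfolioPath X w))) =
      CED s Pr α (portfolioPath X w) := by
  rw [CED_eq_integral_cond hs hα0 hα1 hXm hXi hcont hJK]
  simp only [integral_cond_eq]
  have hsum : ∀ ω, s * (portfolioPath X w ω (K ω) - portfolioPath X w ω (J ω)) =
      ∑ i, w i * (s * (X i (K ω) ω - X i (J ω) ω)) := by
    intro ω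
    unfold portfolioPath
    rw [← Finset.sum_sub_distrib, Finset.mul_sum]
    exact Finset.sum_congr rfl fun i _ => by ring
  simp only [hsum]
  rw [integral_finsetSum _ fun i _ =>
    ((integrable_selected_increment (hXi i) hJ hK s).const_mul (w i)).integrableOn, Finset.mul_sum]
  refine Finset.sum_congr rfl fun i _ => ?_
  rw [integral_const_mul (w i), mul_left_comm]

variable [DecidableEq ι]

/-- The affine function of one exposure that touches the Conditional Expected Drawdown from below:
the drawdown over the optimal interval, averaged over the breach event. -/
theorem affine_le_CED_update (hs : |s| = 1) (hα0 : 0 ≤ α) (hα1 : α < 1)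
    (hXm : ∀ i t, Measurable (X i t)) (hXi : ∀ i t, Integrable (X i t) Pr)
    (hcont : Pr {ω | maxDrawdown s (portfolioPath X w ω) =
      drawdownThreshold Pr (fun ω' => maxDrawdown s (portfolioPath X w ω')) α} = 0)
    (hJ : Measurable J) (hK : Measurable K)
    (hJK : ∀ᵐ ω ∂Pr, IsDrawdownInterval s (portfolioPath X w ω) (J ω) (K ω)) (i : ι) (y : ℝ) :
    CED s Pr α (portfolioPath X w) +
        (y - w i) * ∫ ω, s * (X i (K ω) ω - X i (J ω) ω)
          ∂(cond Pr (breachEvent s Pr α (portfolioPath X w))) ≤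
      CED s Pr α (portfolioPath X (Function.update w i y)) := by
  set A := breachEvent s Pr α (portfolioPath X w) with hAdef
  have hA : Pr.real A = 1 - α := real_breachEvent hs hα0 hα1 hXm hcont
  have hα : 0 < 1 - α := sub_pos.2 hα1
  rw [CED_eq_integral_cond hs hα0 hα1 hXm hXi hcont hJK, integral_cond_eq, integral_cond_eq, hA]
  refine le_of_mul_le_mul_left ?_ hα
  have hintP := integrable_selected_increment
    (Y := fun t ω => portfolioPath X w ω t) (integrable_portfolioPath hXi w) hJ hK s
  have hintX := integrable_selected_increment (hXi i) hJ hK s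
  have hintZ := integrable_maxDrawdown hs
    (integrable_portfolioPath hXi (Function.update w i y))
  calc (1 - α) * ((1 - α)⁻¹ * ∫ ω in A, s * (portfolioPath X w ω (K ω) -
          portfolioPath X w ω (J ω)) ∂Pr +
        (y - w i) * ((1 - α)⁻¹ * ∫ ω in A, s * (X i (K ω) ω - X i (J ω) ω) ∂Pr))
      = ∫ ω in A, s * (portfolioPath X w ω (K ω) - portfolioPath X w ω (J ω)) ∂Pr +
        (y - w i) * ∫ ω in A, s * (X i (K ω) ω - X i (J ω) ω) ∂Pr := by
        field_simp
    _ = ∫ ω in A, (s * (portfolioPath X w ω (K ω) - portfolioPath X w ω (J ω)) +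
        (y - w i) * (s * (X i (K ω) ω - X i (J ω) ω))) ∂Pr := by
        rw [integral_add hintP.integrableOn (hintX.const_mul _).integrableOn,
          integral_const_mul (y - w i)]
    -- The interval need not be optimal after the perturbation, but its increment never exceeds the
    -- maximum.
    _ ≤ ∫ ω in A, maxDrawdown s (portfolioPath X (Function.update w i y) ω) ∂Pr := by
        refine integral_mono_ae (hintP.add (hintX.const_mul _)).integrableOn
          hintZ.integrableOn (ae_restrict_of_ae ?_)
        filter_upwards [hJK] with ω hω
        refine le_of_eq_of_le ?_
          (le_maxDrawdown s (portfolioPath X (Function.update w i y) ω) hω.1)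
        rw [portfolioPath_update, portfolioPath_update]
        ring
    -- Only the probability of `A` matters here: it need not be the breach event of the perturbed
    -- portfolio.
    _ ≤ _ := setIntegral_le_one_sub_mul_tailMean
        (measurable_maxDrawdown hs (measurable_portfolioPath hXm _))
        (fun _ => maxDrawdown_nonneg _ _) hintZ hα0 hα1 hA

/-- Below the threshold the integrand vanishes near `w i`; above it the unique interval stays
optimal, so the integrand is locally affine. The tie is a null event. -/
theorem hasDerivAt_integral_max_maxDrawdown (hs : |s| = 1) (hα0 : 0 ≤ α) (hα1 : α < 1)
    (hXm : ∀ i t, Measurable (X i t)) (hXi : ∀ i t, Integrable (X i t) Pr)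
    (hcont : Pr {ω | maxDrawdown s (portfolioPath X w ω) =
      drawdownThreshold Pr (fun ω' => maxDrawdown s (portfolioPath X w ω')) α} = 0)
    (hJ : Measurable J) (hK : Measurable K)
    (hJK : ∀ᵐ ω ∂Pr, IsDrawdownInterval s (portfolioPath X w ω) (J ω) (K ω))
    (huniq : ∀ᵐ ω ∂Pr, ω ∈ breachEvent s Pr α (portfolioPath X w) →
      ∀ j k, IsDrawdownInterval s (portfolioPath X w ω) j k → j = J ω ∧ k = K ω) (i : ι) :
    HasDerivAt (fun y => ∫ ω, max (maxDrawdown s (portfolioPath X (Function.update w i y) ω) -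
        drawdownThreshold Pr (fun ω' => maxDrawdown s (portfolioPath X w ω')) α) 0 ∂Pr)
      (∫ ω in breachEvent s Pr α (portfolioPath X w), s * (X i (K ω) ω - X i (J ω) ω) ∂Pr)
      (w i) := by
  set c := drawdownThreshold Pr (fun ω' => maxDrawdown s (portfolioPath X w ω')) α with hc
  have hA := measurableSet_breachEvent (Pr := Pr) hs hXm α w
  -- Makes the drawdown positive on the breach event, so the optimal increment strictly beats the
  -- value `0`.
  have hc0 : 0 ≤ c := drawdownThreshold_nonneg
    (measurable_maxDrawdown hs (measurable_portfolioPath hXm w))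
    (fun _ => maxDrawdown_nonneg _ _) ⟨hα0, hα1⟩
  have hZm : ∀ y, Measurable fun ω =>
      max (maxDrawdown s (portfolioPath X (Function.update w i y) ω) - c) 0 := fun y =>
    ((measurable_maxDrawdown hs (measurable_portfolioPath hXm _)).sub_const c).max measurable_const
  have hZi : ∀ y, Integrable (fun ω =>
      max (maxDrawdown s (portfolioPath X (Function.update w i y) ω) - c) 0) Pr := fun y =>
    ((integrable_maxDrawdown hs (integrable_portfolioPath hXi _)).sub
      (integrable_const c)).pos_part
  have hpath : ∀ ω t, HasDerivAt (fun y => portfolioPath X (Function.update w i y) ω t)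
      (X i t ω) (w i) := by
    intro ω t
    simp only [portfolioPath_update]
    simpa using (((hasDerivAt_id (w i)).sub_const (w i)).mul_const (X i t ω)).const_add
      (portfolioPath X w ω t)
  rw [← integral_indicator hA]
  refine (hasDerivAt_integral_of_dominated_loc_of_lip (bound := fun ω => 2 * ∑ t, |X i t ω|)
    (s := univ) univ_mem (Eventually.of_forall fun y => (hZm y).aestronglyMeasurable) (hZi _)
    ((integrable_selected_increment (hXi i) hJ hK s).indicator hA).aestronglyMeasurable
    (Eventually.of_forall fun ω => ?_)
    ((integrable_finsetSum _ fun t _ => (hXi i t).abs).const_mul 2) ?_).2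
  · refine LipschitzOnWith.of_dist_le_mul fun y _ y' _ => ?_
    have hB : 0 ≤ 2 * ∑ t, |X i t ω| :=
      mul_nonneg zero_le_two (Finset.sum_nonneg fun t _ => abs_nonneg _)
    rw [Real.coe_nnabs, abs_of_nonneg hB, Real.dist_eq, Real.dist_eq]
    refine (abs_max_sub_max_le_abs _ _ _).trans ?_
    rw [sub_sub_sub_cancel_right]
    refine (abs_maxDrawdown_sub_le hs _ _).trans_eq ?_
    simp only [portfolioPath_update, add_sub_add_left_eq_sub, ← sub_mul, sub_sub_sub_cancel_right,
      abs_mul]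
    rw [← Finset.mul_sum]
    ring
  · have hne : ∀ᵐ ω ∂Pr, maxDrawdown s (portfolioPath X w ω) ≠ c := by
      rw [ae_iff]
      simpa using hcont
    filter_upwards [hJK, huniq, hne] with ω hω hu hneω
    have hself : portfolioPath X (Function.update w i (w i)) ω = portfolioPath X w ω := by
      rw [Function.update_eq_self]
    have hcontZ : ContinuousAt
        (fun y => maxDrawdown s (portfolioPath X (Function.update w i y) ω)) (w i) :=
      (continuous_maxDrawdown hs).continuousAt.comp
        (continuousAt_pi.2 fun t => (hpath ω t).continuousAt)
    rcases lt_or_gt_of_ne hneω with hlt | hgt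
    · rw [indicator_of_notMem (show ω ∉ breachEvent s Pr α (portfolioPath X w) from
        not_lt.2 hlt.le)]
      refine (hasDerivAt_const (w i) (0 : ℝ)).congr_of_eventuallyEq ?_
      filter_upwards [hcontZ.eventually_lt_const (by simpa only [hself] using hlt)] with y hy
      exact max_eq_right (sub_nonpos.2 hy.le)
    · have hmem : ω ∈ breachEvent s Pr α (portfolioPath X w) := hgt
      rw [indicator_of_mem hmem]
      have hev := eventually_maxDrawdown_eq (s := s) (a := w i)
        (Y := fun y => portfolioPath X (Function.update w i y) ω)
        (fun t => (hpath ω t).continuousAt) (j := J ω) (k := K ω)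
        (by rw [hself]; exact hc0.trans_lt hgt) (by rw [hself]; exact hω)
        (by rw [hself]; exact hu hmem)
      refine ((((hpath ω (K ω)).sub (hpath ω (J ω))).const_mul s).sub_const
        c).congr_of_eventuallyEq ?_
      filter_upwards [hev, hcontZ.eventually_const_lt
        (by simpa only [hself] using hgt)] with y hy hyc
      rw [max_eq_left (sub_nonneg.2 hyc.le), hy]
      rfl

theorem hasDerivAt_CED_update (hs : |s| = 1) (hα0 : 0 ≤ α) (hα1 : α < 1)
    (hXm : ∀ i t, Measurable (X i t)) (hXi : ∀ i t, Integrable (X i t) Pr)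
    (hcont : Pr {ω | maxDrawdown s (portfolioPath X w ω) =
      drawdownThreshold Pr (fun ω' => maxDrawdown s (portfolioPath X w ω')) α} = 0)
    (hJ : Measurable J) (hK : Measurable K)
    (hJK : ∀ᵐ ω ∂Pr, IsDrawdownInterval s (portfolioPath X w ω) (J ω) (K ω))
    (huniq : ∀ᵐ ω ∂Pr, ω ∈ breachEvent s Pr α (portfolioPath X w) →
      ∀ j k, IsDrawdownInterval s (portfolioPath X w ω) j k → j = J ω ∧ k = K ω) (i : ι) :
    HasDerivAt (fun y => CED s Pr α (portfolioPath X (Function.update w i y)))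
      (∫ ω, s * (X i (K ω) ω - X i (J ω) ω)
        ∂(cond Pr (breachEvent s Pr α (portfolioPath X w)))) (w i) := by
  have hα : 0 < 1 - α := sub_pos.2 hα1
  have hg := ((hasDerivAt_integral_max_maxDrawdown hs hα0 hα1 hXm hXi hcont hJ hK hJK huniq
    i).const_add (drawdownThreshold Pr (fun ω' => maxDrawdown s (portfolioPath X w ω')) α *
      (1 - α))).const_mul (1 - α)⁻¹
  -- Writing `1 - α` as the breach probability lets the slope fold into a conditional expectation;
  -- the remaining occurrences are then restored.
  rw [← real_breachEvent hs hα0 hα1 hXm hcont, ← integral_cond_eq,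
    real_breachEvent hs hα0 hα1 hXm hcont] at hg
  refine HasDerivAt.of_sandwich ?_ hg
    (affine_le_CED_update hs hα0 hα1 hXm hXi hcont hJ hK hJK i) (fun y => ?_) ?_ ?_
  · simpa using (((hasDerivAt_id (w i)).sub_const (w i)).mul_const _).const_add
      (CED s Pr α (portfolioPath X w))
  · rw [le_inv_mul_iff₀ hα]
    exact one_sub_mul_tailMean_le (measurable_maxDrawdown hs (measurable_portfolioPath hXm _))
      (fun _ => maxDrawdown_nonneg _ _)
      (integrable_maxDrawdown hs (integrable_portfolioPath hXi _)) hα0 hα1 _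
  · simp
  · rw [Function.update_eq_self, inv_mul_eq_iff_eq_mul₀ hα.ne']
    exact (one_sub_mul_tailMean_eq (measurable_maxDrawdown hs (measurable_portfolioPath hXm _))
      (fun _ => maxDrawdown_nonneg _ _)
      (integrable_maxDrawdown hs (integrable_portfolioPath hXi _)) hα0 hα1).symm

theorem deriv_CED_update (hs : |s| = 1) (hα0 : 0 ≤ α) (hα1 : α < 1)
    (hXm : ∀ i t, Measurable (X i t)) (hXi : ∀ i t, Integrable (X i t) Pr)
    (hcont : Pr {ω | maxDrawdown s (portfolioPath X w ω) =
      drawdownThreshold Pr (fun ω' => maxDrawdown s (portfolioPath X w ω')) α} = 0)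
    (hJ : Measurable J) (hK : Measurable K)
    (hJK : ∀ᵐ ω ∂Pr, IsDrawdownInterval s (portfolioPath X w ω) (J ω) (K ω)) (i : ι)
    (hdiff : PartialDifferentiableAt (fun v => CED s Pr α (portfolioPath X v)) w i) :
    marginalContribution (fun v => CED s Pr α (portfolioPath X v)) w i =
      ∫ ω, s * (X i (K ω) ω - X i (J ω) ω)
        ∂(cond Pr (breachEvent s Pr α (portfolioPath X w))) := by
  refine deriv_eq_of_hasDerivAt_le ?_
    (affine_le_CED_update hs hα0 hα1 hXm hXi hcont hJ hK hJK i) ?_ hdiff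
  · simpa using (((hasDerivAt_id (w i)).sub_const (w i)).mul_const _).const_add
      (CED s Pr α (portfolioPath X w))
  · simp

end Portfolio

/-! ### Assembly of the theorem -/

theorem proposition18 {Ω : Type*} [MeasurableSpace Ω] (Pr : Measure Ω) [IsProbabilityMeasure Pr]
    {ι : Type*} [Fintype ι] [DecidableEq ι] {n : ℕ}
    (s : ℝ) (hs : s = 1 ∨ s = -1)
    (α : ℝ) (hα0 : 0 ≤ α) (hα1 : α < 1)
    (X : ι → Fin n → Ω → ℝ) (hXm : ∀ i t, Measurable (X i t)) (hXi : ∀ i t, Integrable (X i t) Pr)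
    (w : ι → ℝ)
    -- the maximum drawdown of the portfolio is strictly positive
    (hpos : ∀ᵐ ω ∂Pr, 0 < maxDrawdown s (portfolioPath X w ω))
    -- its distribution is continuous at the drawdown threshold
    (hcont : Pr {ω | maxDrawdown s (portfolioPath X w ω) =
      drawdownThreshold Pr (fun ω' => maxDrawdown s (portfolioPath X w ω')) α} = 0) :
    -- there is a random interval on which the maximum drawdown is attained
    (∃ J K : Ω → Fin n, Measurable J ∧ Measurable K ∧
      ∀ᵐ ω ∂Pr, IsDrawdownInterval s (portfolioPath X w ω) (J ω) (K ω)) ∧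
    -- and for every such random interval:
    ∀ J K : Ω → Fin n, Measurable J → Measurable K →
      (∀ᵐ ω ∂Pr, IsDrawdownInterval s (portfolioPath X w ω) (J ω) (K ω)) →
      -- the marginal contributions are the conditional expected drops of the factors
      (∀ i, PartialDifferentiableAt (fun v => CED s Pr α (portfolioPath X v)) w i →
        marginalContribution (fun v => CED s Pr α (portfolioPath X v)) w i =
          ∫ ω, s * (X i (K ω) ω - X i (J ω) ω)
            ∂(cond Pr (breachEvent s Pr α (portfolioPath X w)))) ∧
      -- they exist as soon as the interval is almost surely the only one
      ((∀ᵐ ω ∂Pr, ω ∈ breachEvent s Pr α (portfolioPath X w) →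
          ∀ j k, IsDrawdownInterval s (portfolioPath X w ω) j k → j = J ω ∧ k = K ω) →
        ∀ i, PartialDifferentiableAt (fun v => CED s Pr α (portfolioPath X v)) w i) ∧
      -- and, weighted by the exposures, they add up to the overall drawdown risk
      (∑ i, w i * ∫ ω, s * (X i (K ω) ω - X i (J ω) ω)
            ∂(cond Pr (breachEvent s Pr α (portfolioPath X w))) =
        CED s Pr α (portfolioPath X w)) ∧
      ((∀ i, PartialDifferentiableAt (fun v => CED s Pr α (portfolioPath X v)) w i) →
        ∑ i, w i * marginalContribution (fun v => CED s Pr α (portfolioPath X v)) w i =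
          CED s Pr α (portfolioPath X w)) := by
  have hs' : |s| = 1 := by rcases hs with rfl | rfl <;> simp
  refine ⟨exists_measurable_isDrawdownInterval hs' (measurable_portfolioPath hXm w) hpos,
    fun J K hJ hK hJK => ?_⟩
  have hmarg := deriv_CED_update hs' hα0 hα1 hXm hXi hcont hJ hK hJK
  have hsum := sum_mul_integral_cond_eq_CED hs' hα0 hα1 hXm hXi hcont hJ hK hJK
  refine ⟨hmarg, fun huniq i => (hasDerivAt_CED_update hs' hα0 hα1 hXm hXi hcont hJ hK hJK huniq
    i).differentiableAt, hsum, fun hdiff => ?_⟩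
  rw [← hsum]
  exact Finset.sum_congr rfl fun i _ => by rw [hmarg i (hdiff i)]
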